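/- Let $f:\mathbb{R}\to\mathbb{R}$ be twice differentiable with $f>0$, $f'\ge 0$ and $f''>0$ on $\mathbb{R}$ and $\lim_{u\to\infty} f(u)/u=\infty$. Let $\alpha>0$ and $L_0>0$ be given, and put $F(u)=\int_0^u f(t)\,dt$. For $C>0$ and $\lambda>0$ let $(v_1,u_1)$, $v_1,u_1>0$, be the intersection point of the curve $F(u)=C-\frac{v^2}{2}$ with the line $u=\frac{\sqrt{\lambda}}{\alpha}v$, and let $$L(C;\lambda,\alpha)=2\int_0^{v_1}\frac{dv}{\sqrt{\lambda}\,f\left(F^{-1}\left(C-\frac{v^2}{2}\right)\right)} .$$ Then for every $C>0$ there is exactly one $\lambda=\lambda(C)>0$ with $L(C;\lambda,\alpha)=L_0$, and there exists $C^*>0$ such that $\lambda(C)$ is strictly increasing on $(0,C^*)$ and strictly decreasing on $(C^*,\infty)$. Moreover $\lim_{C\to 0^+}\lambda(C)=0$, $\lim_{C\to\infty}\lambda(C)=0$ and $\lambda(C^*)=\lambda^*$, where $\lambda^*\in(0,\infty)$ is the extremal parameter of the boundary value problem $$u''+\lambda f(u)=0\ \text{ in }(0,L_0),\qquad u'(0)=\alpha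 u(0),\qquad u'(L_0)=-\alpha u(L_0),$$ that is, this problem has a solution for every $0<\lambda\le\lambda^*$ and no solution for $\lambda>\lambda^*$. -/

import Mathlib

namespace RobinPhasePlane

/-- The primitive `F(u) = ∫₀ᵘ f`. -/
noncomputable def primitive (f : ℝ → ℝ) (u : ℝ) : ℝ := ∫ t in (0 : ℝ)..u, f t

/-- The inverse `F⁻¹`. When `f` is continuous and positive, `F` is injective, so this is the genuine
inverse on the range of `F`; the range contains `[0, ∞)` when moreover `f` is nondecreasing. -/
noncomputable def primitiveInv (f : ℝ → ℝ) : ℝ → ℝ := Function.invFun (primitive f)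

/-- The point `(v, u)` of the phase plane lies on the trajectory `F(u) = C - v² / 2` of level `C`. -/
def OnLevelCurve (f : ℝ → ℝ) (C v u : ℝ) : Prop := primitive f u = C - v ^ 2 / 2

/-- The point `(v, u)` lies on the line `u = γ v` with slope `γ = √lam / α`, which expresses the left
Robin condition `u'(0) = α u(0)` in terms of `v = u' / √lam`. -/
def OnRobinLine (α lam v u : ℝ) : Prop := u = Real.sqrt lam / α * v

/-- `L` is the length of the interval that belongs to the trajectory of level `C`:
`L = 2 ∫₀^{v₁} dv / (√lam f(F⁻¹(C - v²/2)))`, where `(v₁, u₁)` with `v₁, u₁ > 0` is the intersection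
point of the level curve and the Robin line. -/
def IsLength (f : ℝ → ℝ) (α lam C L : ℝ) : Prop :=
  ∃ v₁ u₁ : ℝ, 0 < v₁ ∧ 0 < u₁ ∧ OnLevelCurve f C v₁ u₁ ∧ OnRobinLine α lam v₁ u₁ ∧
    L = 2 * ∫ v in (0 : ℝ)..v₁, 1 / (Real.sqrt lam * f (primitiveInv f (C - v ^ 2 / 2)))

/-- `u` is a classical solution, `C¹` on `[0, L]`, of `u'' + lam f(u) = 0` in `(0, L)` with
`u'(0) = α u(0)` and `u'(L) = -α u(L)`; the function `p` is the derivative of `u`. -/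
def IsSolution (f : ℝ → ℝ) (α lam L : ℝ) (u : ℝ → ℝ) : Prop :=
  ∃ p : ℝ → ℝ,
    (∀ x ∈ Set.Icc 0 L, HasDerivWithinAt u (p x) (Set.Icc 0 L) x) ∧
    ContinuousOn p (Set.Icc 0 L) ∧
    (∀ x ∈ Set.Ioo 0 L, ∃ q : ℝ, HasDerivAt p q x ∧ q + lam * f (u x) = 0) ∧
    p 0 = α * u 0 ∧ p L = -α * u L

/-- `lamStar` is the extremal parameter: the boundary value problem on `(0, L)` is solvable for
every `0 < lam ≤ lamStar` and has no solution for `lam > lamStar`. -/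
def IsExtremalParameter (f : ℝ → ℝ) (α L lamStar : ℝ) : Prop :=
  0 < lamStar ∧
    (∀ lam : ℝ, 0 < lam → lam ≤ lamStar → ∃ u : ℝ → ℝ, IsSolution f α lam L u) ∧
    (∀ lam : ℝ, lamStar < lam → ¬ ∃ u : ℝ → ℝ, IsSolution f α lam L u)

end RobinPhasePlane

/-!
In the time variable `√λ x`, centred at the midpoint of the interval, a solution becomes an even
solution of `u'' = -f(u)` that falls from its apex `u 0`, and it is determined by the level
`C = F(u 0)`. Both boundary conditions then say that at the time `S = √λ L₀ / 2` one has
`u S = k S v S`, where `v = -u'` and `k = 2 / (α L₀)`. Since `u` decreases and `v` increases, there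
is exactly one such time `S(C) > 0`, whence `λ(C) = (2 S(C) / L₀)²`. If three levels shared the same
time `S`, the Wronskian of the differences of consecutive trajectories would vanish at `0` and at
`S`, whereas strict convexity of `f` makes it strictly monotone. A continuous positive function of
`C` that tends to `0` at both ends and takes no value three times increases up to its maximum and
decreases from there on, and the maximal value of `λ(C)` is the extremal parameter.
-/

namespace RobinPhasePlane

open Set Filter Topology

/-! ### Primitives, inverses and implicit roots -/

section Primitive

variable {e : ℝ → ℝ}

lemma hasDerivAt_primitive (he : Continuous e) (x : ℝ) : HasDerivAt (primitive e) (e x) x :=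
  (he.integral_hasStrictDerivAt 0 x).hasDerivAt

lemma continuous_primitive (he : Continuous e) : Continuous (primitive e) :=
  continuous_iff_continuousAt.2 fun x => (hasDerivAt_primitive he x).continuousAt

lemma primitive_zero (e : ℝ → ℝ) : primitive e 0 = 0 := intervalIntegral.integral_same

lemma primitive_neg_of_even (heven : ∀ x, e (-x) = e x) (x : ℝ) :
    primitive e (-x) = -primitive e x := by
  have h := intervalIntegral.integral_comp_neg (a := 0) (b := x) e
  simp only [heven, neg_zero] at h
  rw [primitive, primitive, h, intervalIntegral.integral_symm]

lemma strictMono_primitive (he : Continuous e) (hpos : ∀ x, 0 < e x) : StrictMono (primitive e) :=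
  strictMono_of_hasDerivAt_pos (hasDerivAt_primitive he) hpos

lemma primitiveInv_primitive (he : Continuous e) (hpos : ∀ x, 0 < e x) (x : ℝ) :
    primitiveInv e (primitive e x) = x :=
  Function.leftInverse_invFun (strictMono_primitive he hpos).injective x

lemma primitiveInv_zero (he : Continuous e) (hpos : ∀ x, 0 < e x) : primitiveInv e 0 = 0 := by
  simpa only [primitive_zero] using primitiveInv_primitive he hpos 0

end Primitive

/-- Continuity together with a positive lower bound, which makes the primitive a diffeomorphism
of `ℝ`. -/
structure UniformlyPositive (e : ℝ → ℝ) : Prop where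
  continuous : Continuous e
  exists_pos_le : ∃ c, 0 < c ∧ ∀ x, c ≤ e x

namespace UniformlyPositive

variable {e : ℝ → ℝ} (he : UniformlyPositive e)
include he

lemma pos (x : ℝ) : 0 < e x :=
  let ⟨_, hc, hce⟩ := he.exists_pos_le
  hc.trans_le (hce x)

lemma surjective_primitive : Function.Surjective (primitive e) := by
  obtain ⟨c, hc, hce⟩ := he.exists_pos_le
  have hmono : Monotone fun x => primitive e x - c * x :=
    monotone_of_hasDerivAt_nonneg
      (fun x => (hasDerivAt_primitive he.continuous x).sub ((hasDerivAt_id x).const_mul c))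
      fun x => by simpa using hce x
  have hzero : primitive e 0 - c * 0 = 0 := by rw [primitive_zero, mul_zero, sub_zero]
  refine (continuous_primitive he.continuous).surjective
    (tendsto_atTop_mono' _ ?_ (tendsto_id.const_mul_atTop hc))
    (tendsto_atBot_mono' _ ?_ (tendsto_id.const_mul_atBot hc))
  · filter_upwards [eventually_ge_atTop 0] with x hx
    exact sub_nonneg.1 (hzero ▸ hmono hx)
  · filter_upwards [eventually_le_atBot 0] with x hx
    exact sub_nonpos.1 (hzero ▸ hmono hx)

lemma primitive_primitiveInv (y : ℝ) : primitive e (primitiveInv e y) = y :=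
  Function.rightInverse_invFun he.surjective_primitive y

lemma strictMono_primitiveInv : StrictMono (primitiveInv e) := fun a b hab => by
  rwa [← (strictMono_primitive he.continuous he.pos).lt_iff_lt, he.primitive_primitiveInv,
    he.primitive_primitiveInv]

lemma continuous_primitiveInv : Continuous (primitiveInv e) :=
  he.strictMono_primitiveInv.monotone.continuous_of_surjective fun x =>
    ⟨_, primitiveInv_primitive he.continuous he.pos x⟩

lemma hasDerivAt_primitiveInv (y : ℝ) :
    HasDerivAt (primitiveInv e) (e (primitiveInv e y))⁻¹ y :=
  HasDerivAt.of_local_left_inverse he.continuous_primitiveInv.continuousAt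
    (hasDerivAt_primitive he.continuous _) (he.pos _).ne'
    (Eventually.of_forall he.primitive_primitiveInv)

lemma primitiveInv_neg_of_even (heven : ∀ x, e (-x) = e x) (y : ℝ) :
    primitiveInv e (-y) = -primitiveInv e y := by
  refine (strictMono_primitive he.continuous he.pos).injective ?_
  rw [primitive_neg_of_even heven, he.primitive_primitiveInv, he.primitive_primitiveInv]

lemma primitiveInv_pos {y : ℝ} (hy : 0 < y) : 0 < primitiveInv e y := by
  simpa only [primitiveInv_zero he.continuous he.pos] using he.strictMono_primitiveInv hy

end UniformlyPositive

lemma continuousAt_of_strictMonoOn_root {G : ℝ → ℝ → ℝ} {r : ℝ → ℝ} {s : Set ℝ} {x c : ℝ}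
    (hs : s ∈ 𝓝 (r x)) (hrs : ∀ᶠ y in 𝓝 x, r y ∈ s) (hmono : ∀ᶠ y in 𝓝 x, StrictMonoOn (G y) s)
    (hroot : ∀ᶠ y in 𝓝 x, G y (r y) = c) (hG : ∀ v ∈ s, ContinuousAt (fun y => G y v) x) :
    ContinuousAt r x := by
  have hx := hroot.self_of_nhds
  have hsx := mem_of_mem_nhds hs
  refine tendsto_order.2 ⟨fun a ha => ?_, fun b hb => ?_⟩
  · obtain ⟨a', ha', hsa'⟩ :=
      Filter.nonempty_of_mem (inter_mem (Ioo_mem_nhdsLT ha) (mem_nhdsWithin_of_mem_nhds hs))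
    have hlt : G x a' < c := hx ▸ hmono.self_of_nhds hsa' hsx ha'.2
    filter_upwards [hrs, hmono, hroot, (hG a' hsa').eventually_lt_const hlt] with y hy hm hr hlt
    exact ha'.1.trans ((hm.lt_iff_lt hsa' hy).1 (hr.symm ▸ hlt))
  · obtain ⟨b', hb', hsb'⟩ :=
      Filter.nonempty_of_mem (inter_mem (Ioo_mem_nhdsGT hb) (mem_nhdsWithin_of_mem_nhds hs))
    have hlt : c < G x b' := hx ▸ hmono.self_of_nhds hsx hsb' hb'.1
    filter_upwards [hrs, hmono, hroot, (hG b' hsb').eventually_const_lt hlt] with y hy hm hr hlt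
    exact ((hm.lt_iff_lt hy hsb').1 (hr.symm ▸ hlt)).trans hb'.2

/-! ### Trajectories of `u'' = -g(u)` -/

/-- A solution of `u'' = -g(u)` on `ℝ` that starts at rest from its apex `u 0`; the function `v` is
the downward velocity `-u'`. -/
structure IsTrajectory (g u v : ℝ → ℝ) : Prop where
  hasDerivAt_position : ∀ s, HasDerivAt u (-v s) s
  hasDerivAt_velocity : ∀ s, HasDerivAt v (g (u s)) s
  velocity_zero : v 0 = 0

namespace IsTrajectory

variable {g u v : ℝ → ℝ}

lemma energy_eq (h : IsTrajectory g u v) (hg : Continuous g) (s : ℝ) :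
    primitive g (u s) + v s ^ 2 / 2 = primitive g (u 0) := by
  have hE : ∀ s, HasDerivAt (fun s => primitive g (u s) + v s ^ 2 / 2) 0 s := fun s =>
    (((hasDerivAt_primitive hg _).comp s (h.hasDerivAt_position s)).add
      (((h.hasDerivAt_velocity s).pow 2).div_const 2)).congr_deriv (by push_cast; ring)
  have := is_const_of_deriv_eq_zero (fun s => (hE s).differentiableAt) (fun s => (hE s).deriv) s 0
  simpa [h.velocity_zero] using this

section Convex

variable (h : IsTrajectory g u v) (hpos : ∀ x, 0 < g x)
include h hpos

lemma strictMono_velocity : StrictMono v :=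
  strictMono_of_hasDerivAt_pos h.hasDerivAt_velocity fun _ => hpos _

lemma velocity_pos {s : ℝ} (hs : 0 < s) : 0 < v s :=
  h.velocity_zero ▸ h.strictMono_velocity hpos hs

lemma velocity_nonneg {s : ℝ} (hs : 0 ≤ s) : 0 ≤ v s :=
  h.velocity_zero ▸ (h.strictMono_velocity hpos).monotone hs

lemma antitoneOn_position : AntitoneOn u (Ici 0) :=
  antitoneOn_of_hasDerivWithinAt_nonpos (convex_Ici 0)
    (fun s _ => (h.hasDerivAt_position s).continuousAt.continuousWithinAt)
    (fun s _ => (h.hasDerivAt_position s).hasDerivWithinAt)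
    fun _ hs => neg_nonpos.2 (h.velocity_nonneg hpos (interior_subset hs))

lemma concaveOn_position : ConcaveOn ℝ univ u := by
  refine Antitone.concaveOn_univ_of_deriv (fun s => (h.hasDerivAt_position s).differentiableAt) ?_
  rw [funext fun s => (h.hasDerivAt_position s).deriv]
  exact (h.strictMono_velocity hpos).monotone.neg

end Convex

lemma mul_le_velocity (h : IsTrajectory g u v) {m T : ℝ} (hT : 0 ≤ T)
    (hm : ∀ s ∈ Icc 0 T, m ≤ g (u s)) : m * T ≤ v T := by
  have := Convex.mul_sub_le_image_sub_of_le_deriv (convex_Icc 0 T)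
    (fun s _ => (h.hasDerivAt_velocity s).continuousAt.continuousWithinAt)
    (fun s _ => (h.hasDerivAt_velocity s).differentiableAt.differentiableWithinAt)
    (fun s hs => (hm s (interior_subset hs)).trans_eq (h.hasDerivAt_velocity s).deriv.symm)
    0 (left_mem_Icc.2 hT) T (right_mem_Icc.2 hT) hT
  rwa [sub_zero, h.velocity_zero, sub_zero] at this

lemma position_le (h : IsTrajectory g u v) {m T : ℝ} (hT : 0 ≤ T)
    (hm : ∀ s ∈ Icc 0 T, m ≤ g (u s)) : u T ≤ u 0 - m * T ^ 2 / 2 := by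
  have hderiv : ∀ s, HasDerivAt (fun s => u s + m * s ^ 2 / 2) (m * s - v s) s := fun s =>
    ((h.hasDerivAt_position s).add
      ((((hasDerivAt_id s).pow 2).const_mul m).div_const 2)).congr_deriv (by simp; ring)
  have hanti : AntitoneOn (fun s => u s + m * s ^ 2 / 2) (Icc 0 T) :=
    antitoneOn_of_hasDerivWithinAt_nonpos (convex_Icc 0 T)
      (fun s _ => (hderiv s).continuousAt.continuousWithinAt)
      (fun s _ => (hderiv s).hasDerivWithinAt) fun s hs => by
        have hs := interior_subset hs
        exact sub_nonpos.2 (h.mul_le_velocity hs.1 fun r hr => hm r ⟨hr.1, hr.2.trans hs.2⟩)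
  have := hanti (left_mem_Icc.2 hT) (right_mem_Icc.2 hT) hT
  simp only [ne_eq, OfNat.ofNat_ne_zero, not_false_eq_true, zero_pow, mul_zero, zero_div,
    add_zero] at this
  linarith

/-- By concavity the trajectory stays above half its apex up to time `S / 2`, so it falls with
acceleration at least `m` until then. -/
lemma mul_sq_lt_apex (h : IsTrajectory g u v) (hpos : ∀ x, 0 < g x) {m S : ℝ} (hS : 0 < S)
    (huS : 0 < u S) (hm : ∀ y ∈ Icc (u 0 / 2) (u 0), m ≤ g y) : m * S ^ 2 < 4 * u 0 := by
  have hmid : u 0 / 2 < u (S / 2) := by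
    have := (h.concaveOn_position hpos).2 (mem_univ 0) (mem_univ S)
      (show (0 : ℝ) ≤ 1 / 2 by norm_num) (show (0 : ℝ) ≤ 1 / 2 by norm_num) (by norm_num)
    simp only [smul_eq_mul, mul_zero, zero_add, one_div_mul_eq_div] at this
    linarith
  have hanti := h.antitoneOn_position hpos
  have hfall := h.position_le (half_pos hS).le fun s hs => hm (u s)
    ⟨hmid.le.trans (hanti hs.1 (half_pos hS).le hs.2), hanti self_mem_Ici hs.1 hs.1⟩
  linarith

section Comparison

variable {u₁ v₁ u₂ v₂ u₃ v₃ : ℝ → ℝ} {S γ : ℝ}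

lemma velocity_lt_velocity (h₁ : IsTrajectory g u₁ v₁) (h₂ : IsTrajectory g u₂ v₂)
    (hg : Continuous g) (hpos : ∀ x, 0 < g x) (hapex : u₁ 0 < u₂ 0) {s : ℝ} (hs : 0 ≤ s)
    (hle : u₂ s ≤ u₁ s) : v₁ s < v₂ s := by
  have hF := strictMono_primitive hg hpos
  have hpot : primitive g (u₂ s) ≤ primitive g (u₁ s) := hF.monotone hle
  have htotal : primitive g (u₁ 0) < primitive g (u₂ 0) := hF hapex
  have hE₁ := h₁.energy_eq hg s
  have hE₂ := h₂.energy_eq hg s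
  exact lt_of_pow_lt_pow_left₀ 2 (h₂.velocity_nonneg hpos hs) (by linarith)

/-- At a meeting the trajectory with the higher apex is the faster one, so once below it would
stay below, although it hits the line `u = γ v` above the other one. -/
lemma position_lt_position (h₁ : IsTrajectory g u₁ v₁) (h₂ : IsTrajectory g u₂ v₂)
    (hg : Continuous g) (hpos : ∀ x, 0 < g x) (hapex : u₁ 0 < u₂ 0) (hγ : 0 < γ)
    (hS₁ : u₁ S = γ * v₁ S) (hS₂ : u₂ S = γ * v₂ S) {s : ℝ} (hs : s ∈ Icc 0 S) :
    u₁ s < u₂ s := by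
  have hend : u₁ S < u₂ S := by
    by_contra! hle
    have := mul_lt_mul_of_pos_left
      (h₁.velocity_lt_velocity h₂ hg hpos hapex (hs.1.trans hs.2) hle) hγ
    linarith
  by_contra! hle
  have hdiff : ∀ x, HasDerivAt (fun x => u₂ x - u₁ x) (-v₂ x - -v₁ x) x := fun x =>
    (h₂.hasDerivAt_position x).sub (h₁.hasDerivAt_position x)
  have hbelow : u₂ S - u₁ S ≤ 0 :=
    image_le_of_deriv_right_lt_deriv_boundary' (B := fun _ => 0) (B' := fun _ => 0)
      (fun x _ => (hdiff x).continuousAt.continuousWithinAt)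
      (fun x _ => (hdiff x).hasDerivWithinAt) (sub_nonpos.2 hle) continuousOn_const
      (fun x _ => hasDerivWithinAt_const _ _ _)
      (fun x hx hmeet => by
        have := h₁.velocity_lt_velocity h₂ hg hpos hapex (hs.1.trans hx.1) (sub_eq_zero.1 hmeet).le
        linarith)
      (right_mem_Icc.2 hs.2)
  linarith

lemma hasDerivAt_wronskian_sub (h₁ : IsTrajectory g u₁ v₁) (h₂ : IsTrajectory g u₂ v₂)
    (h₃ : IsTrajectory g u₃ v₃) (s : ℝ) :
    HasDerivAt (fun s => (v₂ s - v₁ s) * (u₃ s - u₂ s) - (v₃ s - v₂ s) * (u₂ s - u₁ s))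
      ((g (u₂ s) - g (u₁ s)) * (u₃ s - u₂ s) - (g (u₃ s) - g (u₂ s)) * (u₂ s - u₁ s)) s :=
  ((((h₂.hasDerivAt_velocity s).sub (h₁.hasDerivAt_velocity s)).mul
      ((h₃.hasDerivAt_position s).sub (h₂.hasDerivAt_position s))).sub
    (((h₃.hasDerivAt_velocity s).sub (h₂.hasDerivAt_velocity s)).mul
      ((h₂.hasDerivAt_position s).sub (h₁.hasDerivAt_position s)))).congr_deriv (by simp; ring)

/-- The Wronskian of the consecutive differences vanishes at `0` and at `S`, but strict convexity
makes its derivative negative in between. -/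
lemma not_three_on_line (h₁ : IsTrajectory g u₁ v₁) (h₂ : IsTrajectory g u₂ v₂)
    (h₃ : IsTrajectory g u₃ v₃) (hg : Continuous g) (hpos : ∀ x, 0 < g x)
    (hconv : StrictConvexOn ℝ (Ici 0) g) (h₁₂ : u₁ 0 < u₂ 0) (h₂₃ : u₂ 0 < u₃ 0)
    (hS : 0 < S) (hγ : 0 < γ) (hS₁ : u₁ S = γ * v₁ S) (hS₂ : u₂ S = γ * v₂ S)
    (hS₃ : u₃ S = γ * v₃ S) : False := by
  have hW := h₁.hasDerivAt_wronskian_sub h₂ h₃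
  obtain ⟨x, hx, hW0⟩ := exists_hasDerivAt_eq_zero hS
    (fun x _ => (hW x).continuousAt.continuousWithinAt)
    (by simp only [h₁.velocity_zero, h₂.velocity_zero, h₃.velocity_zero, hS₁, hS₂, hS₃]; ring)
    fun x _ => hW x
  have hx := Ioo_subset_Icc_self hx
  have hlt₁₂ := h₁.position_lt_position h₂ hg hpos h₁₂ hγ hS₁ hS₂ hx
  have hlt₂₃ := h₂.position_lt_position h₃ hg hpos h₂₃ hγ hS₂ hS₃ hx
  have hu₁ : 0 ≤ u₁ x := by
    refine le_trans ?_ (h₁.antitoneOn_position hpos hx.1 hS.le hx.2)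
    exact hS₁ ▸ mul_nonneg hγ.le (h₁.velocity_nonneg hpos hS.le)
  have hslope := hconv.slope_strict_mono_adjacent hu₁ (hu₁.trans (hlt₁₂.trans hlt₂₃).le) hlt₁₂ hlt₂₃
  rw [div_lt_div_iff₀ (sub_pos.2 hlt₁₂) (sub_pos.2 hlt₂₃)] at hslope
  linarith

end Comparison

end IsTrajectory

/-! ### The trajectory of a given level -/

/-- A nonlinearity whose trajectories exist for all time: it is uniformly positive, and it is
bounded on the half-lines `(-∞, a]` down which the trajectories fall. -/
structure Admissible (g : ℝ → ℝ) : Prop extends UniformlyPositive g where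
  bddAbove_image_Iic : ∀ a, BddAbove (g '' Iic a)

/-- The position at which the trajectory of level `C` has velocity `v`. -/
noncomputable def height (g : ℝ → ℝ) (C v : ℝ) : ℝ := primitiveInv g (C - v ^ 2 / 2)

/-- The derivative `ds/dv` of the elapsed time with respect to the velocity, along the trajectory
of level `C`. -/
noncomputable def timeDensity (g : ℝ → ℝ) (C v : ℝ) : ℝ := (g (height g C v))⁻¹

/-- The time that the trajectory of level `C` needs to reach velocity `v`. -/
noncomputable def time (g : ℝ → ℝ) (C : ℝ) : ℝ → ℝ := primitive (timeDensity g C)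

/-- The velocity of the trajectory of level `C` as a function of time. -/
noncomputable def velocity (g : ℝ → ℝ) (C : ℝ) : ℝ → ℝ := primitiveInv (timeDensity g C)

/-- The position of the trajectory of level `C` as a function of time. -/
noncomputable def position (g : ℝ → ℝ) (C s : ℝ) : ℝ := height g C (velocity g C s)

lemma height_neg (g : ℝ → ℝ) (C v : ℝ) : height g C (-v) = height g C v := by
  rw [height, neg_sq, height]

lemma timeDensity_neg (g : ℝ → ℝ) (C v : ℝ) : timeDensity g C (-v) = timeDensity g C v := by
  rw [timeDensity, height_neg, timeDensity]

lemma time_neg (g : ℝ → ℝ) (C v : ℝ) : time g C (-v) = -time g C v :=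
  primitive_neg_of_even (timeDensity_neg g C) v

namespace UniformlyPositive

variable {g : ℝ → ℝ} (hg : UniformlyPositive g)
include hg

lemma primitive_height (C v : ℝ) : primitive g (height g C v) = C - v ^ 2 / 2 :=
  hg.primitive_primitiveInv _

lemma height_eq_iff {C v u : ℝ} : height g C v = u ↔ primitive g u = C - v ^ 2 / 2 := by
  rw [← hg.primitive_height C v, (strictMono_primitive hg.continuous hg.pos).injective.eq_iff,
    eq_comm]

lemma continuous_timeDensity : Continuous fun q : ℝ × ℝ => timeDensity g q.1 q.2 :=
  (hg.continuous.comp (hg.continuous_primitiveInv.comp (by fun_prop))).inv₀ fun _ => (hg.pos _).ne'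

lemma hasDerivAt_height (C v : ℝ) : HasDerivAt (height g C) (-(v * timeDensity g C v)) v :=
  ((hg.hasDerivAt_primitiveInv _).comp v
    ((((hasDerivAt_id v).pow 2).div_const 2).const_sub C)).congr_deriv (by
      rw [timeDensity, height]; simp; ring)

lemma hasDerivAt_time (C v : ℝ) : HasDerivAt (time g C) (timeDensity g C v) v :=
  hasDerivAt_primitive (hg.continuous_timeDensity.comp (Continuous.prodMk_right C)) v

lemma continuous_time_left (v : ℝ) : Continuous fun C => time g C v :=
  intervalIntegral.continuous_parametric_intervalIntegral_of_continuous'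
    hg.continuous_timeDensity 0 v

end UniformlyPositive

namespace Admissible

variable {g : ℝ → ℝ} (hg : Admissible g)
include hg

lemma uniformlyPositive_timeDensity (C : ℝ) : UniformlyPositive (timeDensity g C) := by
  refine ⟨hg.continuous_timeDensity.comp (Continuous.prodMk_right C), ?_⟩
  obtain ⟨M, hM⟩ := hg.bddAbove_image_Iic (primitiveInv g C)
  have hgM : ∀ x ≤ primitiveInv g C, g x ≤ M := fun x hx => hM (mem_image_of_mem g hx)
  refine ⟨M⁻¹, inv_pos.2 ((hg.pos _).trans_le (hgM _ le_rfl)), fun v => ?_⟩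
  refine inv_anti₀ (hg.pos _) (hgM _ (hg.strictMono_primitiveInv.monotone ?_))
  linarith [sq_nonneg v]

lemma velocity_time (C v : ℝ) : velocity g C (time g C v) = v :=
  have h := hg.uniformlyPositive_timeDensity C
  primitiveInv_primitive h.continuous h.pos v

lemma time_velocity (C s : ℝ) : time g C (velocity g C s) = s :=
  (hg.uniformlyPositive_timeDensity C).primitive_primitiveInv s

lemma strictMono_time (C : ℝ) : StrictMono (time g C) :=
  have h := hg.uniformlyPositive_timeDensity C
  strictMono_primitive h.continuous h.pos

lemma velocity_neg (C s : ℝ) : velocity g C (-s) = -velocity g C s :=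
  (hg.uniformlyPositive_timeDensity C).primitiveInv_neg_of_even (timeDensity_neg g C) s

lemma position_neg (C s : ℝ) : position g C (-s) = position g C s := by
  rw [position, hg.velocity_neg, height_neg, position]

lemma isTrajectory (C : ℝ) : IsTrajectory g (position g C) (velocity g C) := by
  have hden := hg.uniformlyPositive_timeDensity C
  have hvel : ∀ s, HasDerivAt (velocity g C) (g (position g C s)) s := fun s =>
    (hden.hasDerivAt_primitiveInv s).congr_deriv (inv_inv _)
  refine ⟨fun s => ?_, hvel, primitiveInv_zero hden.continuous hden.pos⟩
  refine ((hg.hasDerivAt_height C _).comp s (hvel s)).congr_deriv ?_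
  rw [timeDensity, ← position, neg_mul, mul_assoc, inv_mul_cancel₀ (hg.pos _).ne', mul_one]

lemma position_zero (C : ℝ) : position g C 0 = primitiveInv g C := by
  rw [position, (hg.isTrajectory C).velocity_zero, height]
  simp

lemma primitive_position (C s : ℝ) :
    primitive g (position g C s) = C - velocity g C s ^ 2 / 2 := hg.primitive_height C _

lemma continuous_velocity_left (s : ℝ) : Continuous fun C => velocity g C s :=
  continuous_iff_continuousAt.2 fun _ =>
    continuousAt_of_strictMonoOn_root univ_mem (Eventually.of_forall fun _ => mem_univ _)
      (Eventually.of_forall fun C => (hg.strictMono_time C).strictMonoOn _)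
      (Eventually.of_forall fun C => hg.time_velocity C s)
      fun v _ => (hg.continuous_time_left v).continuousAt

lemma continuous_position_left (s : ℝ) : Continuous fun C => position g C s :=
  hg.continuous_primitiveInv.comp
    (continuous_id.sub (((hg.continuous_velocity_left s).pow 2).div_const 2))

end Admissible

/-! ### The half time -/

/-- With the line `u = γ v` of the left Robin condition at time `S = √λ L / 2`, one has
`γ = √λ / α = k * S` for the constant `k = 2 / (α L)`; the defect vanishes at `s` if the trajectory
of level `C` lies on the line of slope `k * s` at time `s`. -/
noncomputable def robinDefect (g : ℝ → ℝ) (k C s : ℝ) : ℝ :=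
  k * s * velocity g C s - position g C s

/-- The positive time at which the trajectory of level `C` meets the boundary condition, that is,
half the length of the interval after rescaling to `λ = 1`. It is meaningful for `C > 0`, where this
time exists and is unique. -/
noncomputable def halfTime (g : ℝ → ℝ) (k C : ℝ) : ℝ :=
  Function.invFunOn (robinDefect g k C) (Ioi 0) 0

namespace Admissible

variable {g : ℝ → ℝ} {k C : ℝ} (hg : Admissible g)
include hg

lemma position_zero_pos (hC : 0 < C) : 0 < position g C 0 :=
  hg.position_zero C ▸ hg.primitiveInv_pos hC

lemma strictMonoOn_robinDefect (hk : 0 < k) : StrictMonoOn (robinDefect g k C) (Ici 0) := by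
  intro a ha b hb hab
  have htraj := hg.isTrajectory C
  have hva := htraj.velocity_nonneg hg.pos ha
  have hv := mul_lt_mul'' (mul_lt_mul_of_pos_left hab hk)
    (htraj.strictMono_velocity hg.pos hab) (mul_nonneg hk.le ha) hva
  have hu := htraj.antitoneOn_position hg.pos ha hb hab.le
  simp only [robinDefect]
  linarith

lemma continuous_robinDefect : Continuous (robinDefect g k C) :=
  have htraj := hg.isTrajectory C
  ((continuous_const.mul continuous_id).mul
    (continuous_iff_continuousAt.2 fun s => (htraj.hasDerivAt_velocity s).continuousAt)).sub
    (continuous_iff_continuousAt.2 fun s => (htraj.hasDerivAt_position s).continuousAt)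

lemma mul_sq_lt_of_position_pos {c s : ℝ} (hc : 0 < c) (hcg : ∀ x, c ≤ g x) (hs : 0 ≤ s)
    (hu : 0 < position g C s) : (c * s) ^ 2 < 2 * C := by
  have hv := (hg.isTrajectory C).mul_le_velocity hs fun r _ => hcg (position g C r)
  have hF := strictMono_primitive hg.continuous hg.pos hu
  rw [primitive_zero, hg.primitive_position] at hF
  have := pow_le_pow_left₀ (mul_nonneg hc.le hs) hv 2
  linarith

lemma exists_robinDefect_eq_zero (hk : 0 < k) (hC : 0 < C) :
    ∃ s ∈ Ioi 0, robinDefect g k C s = 0 := by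
  obtain ⟨c, hc, hcg⟩ := hg.exists_pos_le
  have htraj := hg.isTrajectory C
  have hT : 0 < √(2 * C) / c := by positivity
  have hfallen : position g C (√(2 * C) / c) ≤ 0 := by
    by_contra! hu
    have := hg.mul_sq_lt_of_position_pos hc hcg hT.le hu
    rw [mul_div_cancel₀ _ hc.ne', Real.sq_sqrt (by positivity)] at this
    exact this.false
  have hstart : robinDefect g k C 0 < 0 := by
    simpa [robinDefect] using hg.position_zero_pos hC
  have hend : 0 < robinDefect g k C (√(2 * C) / c) :=
    sub_pos.2 (hfallen.trans_lt (mul_pos (mul_pos hk hT) (htraj.velocity_pos hg.pos hT)))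
  obtain ⟨s, hs, hs0⟩ :=
    intermediate_value_Ioo hT.le hg.continuous_robinDefect.continuousOn ⟨hstart, hend⟩
  exact ⟨s, hs.1, hs0⟩

lemma halfTime_pos (hk : 0 < k) (hC : 0 < C) : 0 < halfTime g k C :=
  Function.invFunOn_mem (hg.exists_robinDefect_eq_zero hk hC)

lemma robinDefect_halfTime (hk : 0 < k) (hC : 0 < C) : robinDefect g k C (halfTime g k C) = 0 :=
  Function.invFunOn_eq (hg.exists_robinDefect_eq_zero hk hC)

lemma position_halfTime (hk : 0 < k) (hC : 0 < C) :
    position g C (halfTime g k C) = k * halfTime g k C * velocity g C (halfTime g k C) :=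
  (sub_eq_zero.1 (hg.robinDefect_halfTime hk hC)).symm

lemma eq_halfTime_iff (hk : 0 < k) (hC : 0 < C) {s : ℝ} (hs : 0 < s) :
    s = halfTime g k C ↔ position g C s = k * s * velocity g C s := by
  rw [← (hg.strictMonoOn_robinDefect hk).injOn.eq_iff hs.le (hg.halfTime_pos hk hC).le,
    hg.robinDefect_halfTime hk hC, robinDefect, sub_eq_zero, eq_comm]

lemma position_halfTime_pos (hk : 0 < k) (hC : 0 < C) : 0 < position g C (halfTime g k C) := by
  have hS := hg.halfTime_pos hk hC
  rw [hg.position_halfTime hk hC]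
  exact mul_pos (mul_pos hk hS) ((hg.isTrajectory C).velocity_pos hg.pos hS)

lemma continuousOn_halfTime (hk : 0 < k) : ContinuousOn (halfTime g k) (Ioi 0) := fun C hC => by
  have hpos : ∀ᶠ B in 𝓝 C, B ∈ Ioi (0 : ℝ) := Ioi_mem_nhds hC
  refine (continuousAt_of_strictMonoOn_root (Ici_mem_nhds (hg.halfTime_pos hk hC))
    (hpos.mono fun B hB => (hg.halfTime_pos hk hB).le)
    (Eventually.of_forall fun B => hg.strictMonoOn_robinDefect hk)
    (hpos.mono fun B hB => hg.robinDefect_halfTime hk hB)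
    fun s _ => Continuous.continuousAt ?_).continuousWithinAt
  exact (continuous_const.mul (hg.continuous_velocity_left s)).sub (hg.continuous_position_left s)

lemma tendsto_halfTime_zero (hk : 0 < k) : Tendsto (halfTime g k) (𝓝[>] 0) (𝓝 0) := by
  obtain ⟨c, hc, hcg⟩ := hg.exists_pos_le
  have hbound : Tendsto (fun C => √(2 * C) / c) (𝓝[>] 0) (𝓝 0) :=
    (Continuous.tendsto' (by fun_prop) 0 0 (by simp)).mono_left nhdsWithin_le_nhds
  refine tendsto_of_tendsto_of_tendsto_of_le_of_le' tendsto_const_nhds hbound ?_ ?_ <;>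
    filter_upwards [self_mem_nhdsWithin] with C hC
  · exact (hg.halfTime_pos hk hC).le
  · have hS := (hg.halfTime_pos hk hC).le
    rw [le_div_iff₀' hc]
    exact Real.le_sqrt_of_sq_le
      (hg.mul_sq_lt_of_position_pos hc hcg hS (hg.position_halfTime_pos hk hC)).le

lemma tendsto_position_zero_atTop : Tendsto (fun C => position g C 0) atTop atTop := by
  simp only [hg.position_zero]
  exact hg.strictMono_primitiveInv.monotone.tendsto_atTop_atTop fun u =>
    ⟨primitive g u, (primitiveInv_primitive hg.continuous hg.pos u).ge⟩

/-- Superlinearity makes the acceleration near the apex large compared with the apex itself. -/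
lemma tendsto_halfTime_atTop (hsuper : Tendsto (fun u => g u / u) atTop atTop) (hk : 0 < k) :
    Tendsto (halfTime g k) atTop (𝓝 0) := by
  refine (tendsto_order.2 ⟨fun a ha => ?_, fun ε hε => ?_⟩)
  · filter_upwards [eventually_gt_atTop 0] with C hC using ha.trans (hg.halfTime_pos hk hC)
  obtain ⟨A, hA⟩ := eventually_atTop.1 (hsuper.eventually_ge_atTop (8 / ε ^ 2))
  filter_upwards [eventually_gt_atTop 0,
    hg.tendsto_position_zero_atTop.eventually_ge_atTop (2 * A)] with C hC hapex
  have hP := hg.position_zero_pos hC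
  have hS := hg.halfTime_pos hk hC
  have hg_ge : ∀ y ∈ Icc (position g C 0 / 2) (position g C 0),
      8 / ε ^ 2 * (position g C 0 / 2) ≤ g y := fun y hy =>
    have hy0 := (half_pos hP).trans_le hy.1
    (mul_le_mul_of_nonneg_left hy.1 (by positivity)).trans
      ((le_div_iff₀ hy0).1 (hA y (by linarith [hy.1])))
  have hlt := (hg.isTrajectory C).mul_sq_lt_apex hg.pos hS (hg.position_halfTime_pos hk hC) hg_ge
  have : (halfTime g k C) ^ 2 < ε ^ 2 := by
    field_simp at hlt
    linarith
  exact lt_of_pow_lt_pow_left₀ 2 hε.le this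

lemma not_three_halfTime (hconv : StrictConvexOn ℝ (Ici 0) g) (hk : 0 < k) {A B : ℝ}
    (hA : 0 < A) (hAB : A < B) (hBC : B < C) (hSAB : halfTime g k A = halfTime g k B)
    (hSBC : halfTime g k B = halfTime g k C) : False := by
  have hB := hA.trans hAB
  have hapex : StrictMono fun C => position g C 0 := by
    simpa only [hg.position_zero] using hg.strictMono_primitiveInv
  exact (hg.isTrajectory A).not_three_on_line (hg.isTrajectory B) (hg.isTrajectory C)
    hg.continuous hg.pos hconv (hapex hAB) (hapex hBC) (hg.halfTime_pos hk hB)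
    (mul_pos hk (hg.halfTime_pos hk hB)) (hSAB ▸ hg.position_halfTime hk hA)
    (hg.position_halfTime hk hB) (hSBC ▸ hg.position_halfTime hk (hB.trans hBC))

end Admissible

/-! ### The length and the parameter -/

/-- The parameter `λ(C)` for which the trajectory of level `C` has length `L`. -/
noncomputable def robinParameter (g : ℝ → ℝ) (α L C : ℝ) : ℝ :=
  (2 * halfTime g (2 / (α * L)) C / L) ^ 2

lemma integral_eq_time_div_sqrt (g : ℝ → ℝ) (C μ v : ℝ) :
    ∫ w in (0 : ℝ)..v, 1 / (√μ * g (primitiveInv g (C - w ^ 2 / 2))) = time g C v / √μ := by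
  rw [time, primitive, ← intervalIntegral.integral_div]
  refine intervalIntegral.integral_congr fun w _ => ?_
  simp only [timeDensity, height, one_div (_ * _), mul_inv_rev, div_eq_mul_inv (_⁻¹)]

lemma tendsto_robinParameter {g : ℝ → ℝ} {α L : ℝ} {l : Filter ℝ}
    (h : Tendsto (halfTime g (2 / (α * L))) l (𝓝 0)) : Tendsto (robinParameter g α L) l (𝓝 0) := by
  have hsq := ((h.const_mul 2).div_const L).pow 2
  rwa [mul_zero, zero_div, zero_pow two_ne_zero] at hsq

namespace Admissible

variable {g : ℝ → ℝ} {α μ C L : ℝ} (hg : Admissible g)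
include hg

lemma isLength_iff (hα : 0 < α) (hμ : 0 < μ) (hL : 0 < L) :
    IsLength g α μ C L ↔ position g C (√μ * L / 2) = √μ / α * velocity g C (√μ * L / 2) := by
  have : 0 < √μ := Real.sqrt_pos.2 hμ
  constructor
  · rintro ⟨v, u, -, -, hcurve, hline, hlength⟩
    have htime : √μ * L / 2 = time g C v := by
      rw [hlength, integral_eq_time_div_sqrt]
      field_simp
    rw [position, htime, hg.velocity_time, hg.height_eq_iff.2 hcurve, hline]
  · intro h
    have hv := (hg.isTrajectory C).velocity_pos hg.pos (show 0 < √μ * L / 2 by positivity)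
    refine ⟨velocity g C (√μ * L / 2), position g C (√μ * L / 2), hv, ?_,
      hg.primitive_position _ _, h, ?_⟩
    · rw [h]
      positivity
    · rw [integral_eq_time_div_sqrt, hg.time_velocity]
      field_simp

lemma robinParameter_pos (hα : 0 < α) (hL : 0 < L) (hC : 0 < C) : 0 < robinParameter g α L C := by
  have := hg.halfTime_pos (k := 2 / (α * L)) (by positivity) hC
  rw [robinParameter]
  positivity

lemma eq_robinParameter_iff (hα : 0 < α) (hL : 0 < L) (hC : 0 < C) (hμ : 0 < μ) :
    μ = robinParameter g α L C ↔ √μ * L / 2 = halfTime g (2 / (α * L)) C := by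
  have := hg.halfTime_pos (k := 2 / (α * L)) (by positivity) hC
  rw [robinParameter, ← Real.sqrt_eq_iff_eq_sq hμ.le (by positivity)]
  field_simp

lemma isLength_iff_eq_robinParameter (hα : 0 < α) (hL : 0 < L) (hC : 0 < C) :
    (0 < μ ∧ IsLength g α μ C L) ↔ μ = robinParameter g α L C := by
  have key : 0 < μ → (IsLength g α μ C L ↔ μ = robinParameter g α L C) := fun hμ => by
    rw [hg.isLength_iff hα hμ hL, hg.eq_robinParameter_iff hα hL hC hμ,
      hg.eq_halfTime_iff (by positivity) hC (by positivity)]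
    rw [show 2 / (α * L) * (√μ * L / 2) = √μ / α by field_simp]
  refine ⟨fun h => (key h.1).1 h.2, fun h => ?_⟩
  have hμ : 0 < μ := h ▸ hg.robinParameter_pos hα hL hC
  exact ⟨hμ, (key hμ).2 h⟩

lemma not_three_robinParameter (hconv : StrictConvexOn ℝ (Ici 0) g) (hα : 0 < α) (hL : 0 < L)
    {A B : ℝ} (hA : 0 < A) (hAB : A < B) (hBC : B < C)
    (hpAB : robinParameter g α L A = robinParameter g α L B)
    (hpBC : robinParameter g α L B = robinParameter g α L C) : False := by
  have hB := hA.trans hAB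
  have hC := hB.trans hBC
  have hp := hg.robinParameter_pos hα hL hB
  have hSA := (hg.eq_robinParameter_iff hα hL hA hp).1 hpAB.symm
  have hSB := (hg.eq_robinParameter_iff hα hL hB hp).1 rfl
  have hSC := (hg.eq_robinParameter_iff hα hL hC hp).1 hpBC
  exact hg.not_three_halfTime hconv (by positivity) hA hAB hBC
    (hSA.symm.trans hSB) (hSB.symm.trans hSC)

lemma continuousOn_robinParameter (hα : 0 < α) (hL : 0 < L) :
    ContinuousOn (robinParameter g α L) (Ioi 0) :=
  (((hg.continuousOn_halfTime (by positivity)).const_mul 2).div_const L).pow 2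

lemma tendsto_robinParameter_zero (hα : 0 < α) (hL : 0 < L) :
    Tendsto (robinParameter g α L) (𝓝[>] 0) (𝓝 0) :=
  tendsto_robinParameter (hg.tendsto_halfTime_zero (by positivity))

lemma tendsto_robinParameter_atTop (hsuper : Tendsto (fun u => g u / u) atTop atTop)
    (hα : 0 < α) (hL : 0 < L) : Tendsto (robinParameter g α L) atTop (𝓝 0) :=
  tendsto_robinParameter (hg.tendsto_halfTime_atTop hsuper (by positivity))

end Admissible

/-! ### Functions that take no value three times -/

lemma exists_isMaxOn_Ioi {φ : ℝ → ℝ} (hcont : ContinuousOn φ (Ioi 0)) (hpos : ∀ x, 0 < x → 0 < φ x)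
    (hzero : Tendsto φ (𝓝[>] 0) (𝓝 0)) (htop : Tendsto φ atTop (𝓝 0)) :
    ∃ m, 0 < m ∧ IsMaxOn φ (Ioi 0) m := by
  have hexp : Continuous (φ ∘ Real.exp) :=
    hcont.comp_continuous Real.continuous_exp Real.exp_pos
  have hfar : ∀ᶠ t in cocompact ℝ, (φ ∘ Real.exp) t ≤ (φ ∘ Real.exp) 0 := by
    have hone : 0 < (φ ∘ Real.exp) 0 := hpos _ (Real.exp_pos 0)
    rw [cocompact_eq_atBot_atTop]
    exact eventually_sup.2
      ⟨((hzero.comp Real.tendsto_exp_atBot_nhdsGT).eventually_lt_const hone).mono fun _ => le_of_lt,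
        ((htop.comp Real.tendsto_exp_atTop).eventually_lt_const hone).mono fun _ => le_of_lt⟩
  obtain ⟨t, ht⟩ := hexp.exists_forall_ge' 0 hfar
  exact ⟨Real.exp t, Real.exp_pos t, fun x hx =>
    (congrArg φ (Real.exp_log hx)).symm.trans_le (ht (Real.log x))⟩

section Unimodal

variable {φ : ℝ → ℝ}

lemma Ioc_subset_image_Ioc {m : ℝ} (hm : 0 < m) (hcont : ContinuousOn φ (Ioi 0))
    (hzero : Tendsto φ (𝓝[>] 0) (𝓝 0)) : Ioc 0 (φ m) ⊆ φ '' Ioc 0 m :=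
  isPreconnected_Ioc.intermediate_value_Ioc (right_mem_Ioc.2 hm)
    (le_principal_iff.2 (Ioc_mem_nhdsGT hm)) (hcont.mono Ioc_subset_Ioi_self) hzero

lemma Ioc_subset_image_Ici {m : ℝ} (hm : 0 < m) (hcont : ContinuousOn φ (Ioi 0))
    (htop : Tendsto φ atTop (𝓝 0)) : Ioc 0 (φ m) ⊆ φ '' Ici m :=
  isPreconnected_Ici.intermediate_value_Ioc self_mem_Ici
    (le_principal_iff.2 (Ici_mem_atTop m)) (hcont.mono (Ici_subset_Ioi.2 hm)) htop

/-- A failure of monotonicity on one side of the maximum produces a value taken twice on that side,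
and the same value is taken once more on the other side. -/
lemma exists_strictMonoOn_strictAntiOn (hcont : ContinuousOn φ (Ioi 0))
    (hpos : ∀ x, 0 < x → 0 < φ x) (hzero : Tendsto φ (𝓝[>] 0) (𝓝 0))
    (htop : Tendsto φ atTop (𝓝 0))
    (hthree : ∀ a b c, 0 < a → a < b → b < c → φ a = φ b → φ b = φ c → False) :
    ∃ m, 0 < m ∧ StrictMonoOn φ (Ioo 0 m) ∧ StrictAntiOn φ (Ioi m) ∧
      φ '' Ioi 0 = Ioc 0 (φ m) := by
  obtain ⟨m, hm, hmax⟩ := exists_isMaxOn_Ioi hcont hpos hzero htop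
  have hleft : ∀ x, 0 < x → Ioc 0 (φ x) ⊆ φ '' Ioc 0 x := fun x hx =>
    Ioc_subset_image_Ioc hx hcont hzero
  have hright : ∀ x, 0 < x → Ioc 0 (φ x) ⊆ φ '' Ici x := fun x hx =>
    Ioc_subset_image_Ici hx hcont htop
  refine ⟨m, hm, fun a ha b hb hab => ?_, fun a ha b hb hab => ?_,
    Subset.antisymm (image_subset_iff.2 fun x hx => ⟨hpos x hx, hmax hx⟩)
      ((hleft m hm).trans (image_mono Ioc_subset_Ioi_self))⟩
  · by_contra! hle
    obtain ⟨x, hx, hxb⟩ := hleft a ha.1 ⟨hpos b hb.1, hle⟩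
    obtain ⟨z, hz, hzb⟩ := hright m hm ⟨hpos b hb.1, hmax hb.1⟩
    exact hthree x b z hx.1 (hx.2.trans_lt hab) (hb.2.trans_le hz) hxb hzb.symm
  · have ha0 := hm.trans ha
    by_contra! hle
    obtain ⟨x, hx, hxa⟩ := hleft m hm ⟨hpos a ha0, hmax ha0⟩
    obtain ⟨z, hz, hza⟩ := hright b (hm.trans hb) ⟨hpos a ha0, hle⟩
    exact hthree x a z hx.1 (hx.2.trans_lt ha) (hab.trans_le hz) hxa hza.symm

end Unimodal

/-! ### The boundary value problem -/

lemma sub_eq_of_hasDerivAt_const {φ : ℝ → ℝ} {a b c : ℝ} (hφ : ContinuousOn φ (Icc a b))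
    (hd : ∀ x ∈ Ioo a b, HasDerivAt φ c x) {x : ℝ} (hx : x ∈ Icc a b) :
    φ x - φ a = c * (x - a) := by
  rcases hx.1.eq_or_lt with rfl | hax
  · rw [sub_self, sub_self, mul_zero]
  obtain ⟨y, -, h⟩ := exists_hasDerivAt_eq_slope φ (fun _ => c) hax
    (hφ.mono (Icc_subset_Icc_right hx.2)) fun y hy => hd y ⟨hy.1, hy.2.trans_le hx.2⟩
  rw [h, div_mul_cancel₀ _ (sub_pos.2 hax).ne']

/-- A solution `u` of the boundary value problem together with its derivative `p`, the differential
equation being solved for the derivative of `p`. -/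
structure IsSolutionPair (g : ℝ → ℝ) (α μ L : ℝ) (u p : ℝ → ℝ) : Prop where
  hasDerivWithinAt_fst : ∀ x ∈ Icc 0 L, HasDerivWithinAt u (p x) (Icc 0 L) x
  continuousOn_snd : ContinuousOn p (Icc 0 L)
  hasDerivAt_snd : ∀ x ∈ Ioo 0 L, HasDerivAt p (-(μ * g (u x))) x
  left_condition : p 0 = α * u 0
  right_condition : p L = -α * u L

lemma isSolution_iff {g u : ℝ → ℝ} {α μ L : ℝ} :
    IsSolution g α μ L u ↔ ∃ p, IsSolutionPair g α μ L u p := by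
  refine exists_congr fun p => ⟨fun ⟨hu, hp, hq, h0, hL⟩ => ⟨hu, hp, fun x hx => ?_, h0, hL⟩,
    fun h => ⟨h.hasDerivWithinAt_fst, h.continuousOn_snd,
      fun x hx => ⟨_, h.hasDerivAt_snd x hx, neg_add_cancel _⟩,
      h.left_condition, h.right_condition⟩⟩
  obtain ⟨q, hq, heq⟩ := hq x hx
  rwa [← eq_neg_of_add_eq_zero_left heq]

namespace IsSolutionPair

variable {g u p : ℝ → ℝ} {α μ L : ℝ} (h : IsSolutionPair g α μ L u p)
include h

lemma continuousOn_fst : ContinuousOn u (Icc 0 L) := fun x hx =>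
  (h.hasDerivWithinAt_fst x hx).continuousWithinAt

lemma hasDerivAt_fst {x : ℝ} (hx : x ∈ Ioo 0 L) : HasDerivAt u (p x) x :=
  (h.hasDerivWithinAt_fst x (Ioo_subset_Icc_self hx)).hasDerivAt (Icc_mem_nhds hx.1 hx.2)

lemma strictAntiOn_snd (hpos : ∀ x, 0 < g x) (hμ : 0 < μ) : StrictAntiOn p (Icc 0 L) := by
  refine strictAntiOn_of_hasDerivWithinAt_neg (f' := fun x => -(μ * g (u x))) (convex_Icc 0 L)
    h.continuousOn_snd (fun x hx => (h.hasDerivAt_snd x ?_).hasDerivWithinAt)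
    fun x _ => neg_neg_of_pos (mul_pos hμ (hpos _))
  rwa [interior_Icc] at hx

lemma concaveOn_fst (hpos : ∀ x, 0 < g x) (hμ : 0 < μ) : ConcaveOn ℝ (Icc 0 L) u := by
  have hderiv : ∀ x ∈ Ioo 0 L, deriv u x = p x := fun x hx => (h.hasDerivAt_fst hx).deriv
  refine AntitoneOn.concaveOn_of_deriv (convex_Icc 0 L) h.continuousOn_fst ?_ ?_ <;>
    rw [interior_Icc]
  · exact fun x hx => (h.hasDerivAt_fst hx).differentiableAt.differentiableWithinAt
  · exact (((h.strictAntiOn_snd hpos hμ).mono Ioo_subset_Icc_self).antitoneOn).congr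
      fun x hx => (hderiv x hx).symm

lemma left_add_right_pos (hpos : ∀ x, 0 < g x) (hα : 0 < α) (hμ : 0 < μ) (hL : 0 < L) :
    0 < u 0 + u L := by
  have := h.strictAntiOn_snd hpos hμ (left_mem_Icc.2 hL.le) (right_mem_Icc.2 hL.le) hL
  rw [h.left_condition, h.right_condition] at this
  exact pos_of_mul_pos_right (by linarith : 0 < α * (u 0 + u L)) hα.le

lemma left_pos (hpos : ∀ x, 0 < g x) (hα : 0 < α) (hμ : 0 < μ) (hL : 0 < L) : 0 < u 0 := by
  by_contra! hu
  have hanti := h.strictAntiOn_snd hpos hμ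
  have h0 : (0 : ℝ) ∈ Icc 0 L := left_mem_Icc.2 hL.le
  have hp0 : p 0 ≤ 0 := h.left_condition ▸ mul_nonpos_of_nonneg_of_nonpos hα.le hu
  have hdecreasing := strictAntiOn_of_hasDerivWithinAt_neg (convex_Icc 0 L) h.continuousOn_fst
    (fun x hx => (h.hasDerivAt_fst (interior_Icc.subset hx)).hasDerivWithinAt)
    (fun x hx => (hanti h0 (interior_subset hx) (interior_Icc.subset hx).1).trans_le hp0)
  have := hdecreasing h0 (right_mem_Icc.2 hL.le) hL
  linarith [h.left_add_right_pos hpos hα hμ hL]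

lemma right_pos (hpos : ∀ x, 0 < g x) (hα : 0 < α) (hμ : 0 < μ) (hL : 0 < L) : 0 < u L := by
  by_contra! hu
  have hanti := h.strictAntiOn_snd hpos hμ
  have hL' : L ∈ Icc 0 L := right_mem_Icc.2 hL.le
  have hpL : 0 ≤ p L := h.right_condition ▸ mul_nonneg_of_nonpos_of_nonpos (neg_nonpos.2 hα.le) hu
  have hincreasing := strictMonoOn_of_hasDerivWithinAt_pos (convex_Icc 0 L) h.continuousOn_fst
    (fun x hx => (h.hasDerivAt_fst (interior_Icc.subset hx)).hasDerivWithinAt)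
    (fun x hx => hpL.trans_lt (hanti (interior_subset hx) hL' (interior_Icc.subset hx).2))
  have := hincreasing (left_mem_Icc.2 hL.le) hL' hL
  linarith [h.left_add_right_pos hpos hα hμ hL]

lemma pos (hpos : ∀ x, 0 < g x) (hα : 0 < α) (hμ : 0 < μ) (hL : 0 < L) {x : ℝ}
    (hx : x ∈ Icc 0 L) : 0 < u x :=
  (lt_min (h.left_pos hpos hα hμ hL) (h.right_pos hpos hα hμ hL)).trans_le
    ((h.concaveOn_fst hpos hμ).min_le_of_mem_Icc (left_mem_Icc.2 hL.le) (right_mem_Icc.2 hL.le) hx)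

lemma energy_eq (hg : Continuous g) (hμ : 0 < μ) {x : ℝ} (hx : x ∈ Icc 0 L) :
    primitive g (u x) + (p x / √μ) ^ 2 / 2 = primitive g (u 0) + (p 0 / √μ) ^ 2 / 2 := by
  have hE := sub_eq_of_hasDerivAt_const (c := 0)
    (φ := fun x => primitive g (u x) + (p x / √μ) ^ 2 / 2)
    (((continuous_primitive hg).comp_continuousOn h.continuousOn_fst).add
      (((h.continuousOn_snd.div_const _).pow 2).div_const 2)) (fun y hy => ?_) hx
  · linarith
  · refine (((hasDerivAt_primitive hg _).comp y (h.hasDerivAt_fst hy)).add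
      ((((h.hasDerivAt_snd y hy).div_const (√μ)).pow 2).div_const 2)).congr_deriv ?_
    have hsq : √μ ^ 2 = μ := Real.sq_sqrt hμ.le
    simp only [Nat.cast_ofNat, Nat.add_one_sub_one, pow_one]
    field_simp
    rw [hsq]
    ring

/-- The energy is a strictly increasing function of the boundary value. -/
lemma right_eq_left (hg : Continuous g) (hpos : ∀ x, 0 < g x) (hα : 0 < α) (hμ : 0 < μ)
    (hL : 0 < L) : u L = u 0 := by
  have hmono : StrictMonoOn (fun y => primitive g y + (α * y / √μ) ^ 2 / 2) (Ici 0) :=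
    ((strictMono_primitive hg hpos).strictMonoOn _).add_monotone fun a ha b _ hab => by
      have : 0 ≤ a := ha
      gcongr
  refine hmono.injOn (h.right_pos hpos hα hμ hL).le (h.left_pos hpos hα hμ hL).le ?_
  have hE := h.energy_eq hg hμ (right_mem_Icc.2 hL.le)
  rwa [h.left_condition, h.right_condition, neg_mul, neg_div, neg_sq] at hE

end IsSolutionPair

namespace Admissible

variable {g u p : ℝ → ℝ} {α μ L : ℝ} (hg : Admissible g)
include hg

lemma exists_isLength_of_isSolutionPair (h : IsSolutionPair g α μ L u p) (hα : 0 < α) (hμ : 0 < μ)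
    (hL : 0 < L) : ∃ C, 0 < C ∧ IsLength g α μ C L := by
  set C := primitive g (u 0) + (p 0 / √μ) ^ 2 / 2
  have : 0 < √μ := Real.sqrt_pos.2 hμ
  have hu0 := h.left_pos hg.pos hα hμ hL
  have hF := strictMono_primitive hg.continuous hg.pos hu0
  rw [primitive_zero] at hF
  have hheight : ∀ x ∈ Icc 0 L, height g C (p x / √μ) = u x := fun x hx =>
    hg.height_eq_iff.2 (eq_sub_of_add_eq (h.energy_eq hg.continuous hμ hx))
  have helapsed : time g C (p L / √μ) - time g C (p 0 / √μ) = -√μ * (L - 0) :=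
    sub_eq_of_hasDerivAt_const (φ := fun x => time g C (p x / √μ))
      (fun x hx => (hg.hasDerivAt_time C _).continuousAt.comp_continuousWithinAt
        ((h.continuousOn_snd.div_const _) x hx))
      (fun x hx => by
        refine ((hg.hasDerivAt_time C _).comp x
          ((h.hasDerivAt_snd x hx).div_const _)).congr_deriv ?_
        have hne := (hg.pos (u x)).ne'
        rw [timeDensity, hheight x (Ioo_subset_Icc_self hx)]
        field_simp
        rw [Real.sq_sqrt hμ.le]) (right_mem_Icc.2 hL.le)
  have hopposite : p L / √μ = -(p 0 / √μ) := by
    rw [h.right_condition, h.left_condition, h.right_eq_left hg.continuous hg.pos hα hμ hL]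
    ring
  have htime : √μ * L / 2 = time g C (p 0 / √μ) := by
    rw [hopposite, time_neg] at helapsed
    linarith
  refine ⟨C, by positivity, (hg.isLength_iff hα hμ hL).2 ?_⟩
  rw [position, htime, hg.velocity_time, hheight 0 (left_mem_Icc.2 hL.le), h.left_condition]
  field_simp

/-- Centring the trajectory at the midpoint of the interval makes the two boundary conditions
mirror images of each other. -/
lemma exists_isSolutionPair_of_isLength {C : ℝ} (hα : 0 < α) (hμ : 0 < μ) (hL : 0 < L)
    (h : IsLength g α μ C L) : ∃ u p, IsSolutionPair g α μ L u p := by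
  have hend := (hg.isLength_iff hα hμ hL).1 h
  have : 0 < √μ := Real.sqrt_pos.2 hμ
  have hline : ∀ x, HasDerivAt (fun x => √μ * (x - L / 2)) (√μ) x := fun x => by
    simpa using ((hasDerivAt_id x).sub_const (L / 2)).const_mul (√μ)
  have htraj := hg.isTrajectory C
  have hp : ∀ x, HasDerivAt (fun x => -velocity g C (√μ * (x - L / 2)) * √μ)
      (-(μ * g (position g C (√μ * (x - L / 2))))) x := fun x =>
    (((htraj.hasDerivAt_velocity _).comp x (hline x)).neg.mul_const _).congr_deriv (by
      linear_combination (-g (position g C (√μ * (x - L / 2)))) * Real.mul_self_sqrt hμ.le)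
  refine ⟨fun x => position g C (√μ * (x - L / 2)), _,
    fun x _ => ((htraj.hasDerivAt_position _).comp x (hline x)).hasDerivWithinAt,
    fun x _ => (hp x).continuousAt.continuousWithinAt, fun x _ => hp x, ?_, ?_⟩
  · rw [show √μ * (0 - L / 2) = -(√μ * L / 2) by ring, hg.velocity_neg, hg.position_neg, hend]
    field_simp
  · rw [show √μ * (L - L / 2) = √μ * L / 2 by ring, hend]
    field_simp

lemma exists_isSolution_iff (hα : 0 < α) (hμ : 0 < μ) (hL : 0 < L) :
    (∃ u, IsSolution g α μ L u) ↔ μ ∈ robinParameter g α L '' Ioi 0 := by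
  constructor
  · rintro ⟨u, hu⟩
    obtain ⟨p, hp⟩ := isSolution_iff.1 hu
    obtain ⟨C, hC, hlength⟩ := hg.exists_isLength_of_isSolutionPair hp hα hμ hL
    exact ⟨C, hC, ((hg.isLength_iff_eq_robinParameter hα hL hC).1 ⟨hμ, hlength⟩).symm⟩
  · rintro ⟨C, hC, hparam⟩
    have hlength := ((hg.isLength_iff_eq_robinParameter hα hL hC).2 hparam.symm).2
    obtain ⟨u, p, hp⟩ := hg.exists_isSolutionPair_of_isLength hα hμ hL hlength
    exact ⟨u, isSolution_iff.2 ⟨p, hp⟩⟩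

lemma isExtremalParameter_of_image_eq {lamStar : ℝ} (hα : 0 < α) (hL : 0 < L)
    (hstar : 0 < lamStar) (himage : robinParameter g α L '' Ioi 0 = Ioc 0 lamStar) :
    IsExtremalParameter g α L lamStar := by
  have hiff : ∀ μ, 0 < μ → ((∃ u, IsSolution g α μ L u) ↔ μ ∈ Ioc 0 lamStar) := fun μ hμ => by
    rw [hg.exists_isSolution_iff hα hμ hL, himage]
  exact ⟨hstar, fun μ hμ hle => (hiff μ hμ).2 ⟨hμ, hle⟩, fun μ hlt hu =>
    (((hiff μ (hstar.trans hlt)).1 hu).2.trans_lt hlt).false⟩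

end Admissible

/-! ### Restriction to nonnegative arguments -/

/-- The nonlinearity `f` with its values on negative arguments replaced by `f 0`. Positive solutions
do not see the difference, and unlike `f` the truncation stays away from `0`. -/
def trunc (f : ℝ → ℝ) (u : ℝ) : ℝ := f (max u 0)

lemma eqOn_trunc (f : ℝ → ℝ) : EqOn f (trunc f) (Ici 0) := fun _ hu =>
  (congrArg f (max_eq_left hu)).symm

lemma tendsto_atTop_of_tendsto_div {f : ℝ → ℝ}
    (hsuper : Tendsto (fun u => f u / u) atTop atTop) : Tendsto f atTop atTop :=
  (hsuper.atTop_mul_atTop₀ tendsto_id).congr' (by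
    filter_upwards [eventually_ne_atTop 0] with u hu using div_mul_cancel₀ _ hu)

lemma admissible_trunc {f : ℝ → ℝ} (hf : Continuous f) (hpos : ∀ u, 0 ≤ u → 0 < f u)
    (htop : Tendsto f atTop atTop) : Admissible (trunc f) := by
  refine ⟨⟨hf.comp (continuous_id.max continuous_const), ?_⟩, fun a => ?_⟩
  · obtain ⟨x, hx, hmin⟩ := hf.continuousOn.exists_isMinOn' isClosed_Ici self_mem_Ici (by
      rw [cocompact_eq_atBot_atTop, inf_sup_right, (disjoint_atBot_principal_Ici 0).eq_bot,
        bot_sup_eq]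
      exact (htop.eventually_ge_atTop _).filter_mono inf_le_left)
    exact ⟨f x, hpos x hx, fun u => hmin (le_max_right u 0)⟩
  · refine (isCompact_Icc.bddAbove_image (hf.continuousOn (s := Icc 0 (max a 0)))).mono ?_
    rintro _ ⟨u, hu, rfl⟩
    exact mem_image_of_mem f ⟨le_max_right u 0, max_le_max_right 0 hu⟩

section Congr

variable {f g : ℝ → ℝ} {α μ C L : ℝ} (hfg : EqOn f g (Ici 0))
include hfg

lemma primitive_congr {u : ℝ} (hu : 0 ≤ u) : primitive f u = primitive g u :=
  intervalIntegral.integral_congr fun _ ht => hfg (uIcc_of_le hu ▸ ht).1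

lemma comp_primitiveInv_congr (hf : Continuous f) (hpos : ∀ x, 0 < f x) (hg : UniformlyPositive g)
    {y : ℝ} (hy : 0 < y) : f (primitiveInv f y) = g (primitiveInv g y) := by
  have hx := (hg.primitiveInv_pos hy).le
  have hinv := primitiveInv_primitive hf hpos (primitiveInv g y)
  rw [primitive_congr hfg hx, hg.primitive_primitiveInv] at hinv
  rw [hinv, hfg hx]

lemma isLength_congr (hf : Continuous f) (hpos : ∀ x, 0 < f x) (hg : UniformlyPositive g) :
    IsLength f α μ C L ↔ IsLength g α μ C L := by
  refine exists₂_congr fun v u => and_congr_right fun hv => and_congr_right fun hu => ?_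
  rw [OnLevelCurve, OnLevelCurve, primitive_congr hfg hu.le]
  refine and_congr_right fun hcurve => ?_
  have hlevel : 0 < C - v ^ 2 / 2 := by
    rw [← hcurve, ← primitive_zero g]
    exact strictMono_primitive hg.continuous hg.pos hu
  have hint : EqOn (fun w => 1 / (√μ * f (primitiveInv f (C - w ^ 2 / 2))))
      (fun w => 1 / (√μ * g (primitiveInv g (C - w ^ 2 / 2)))) (uIcc 0 v) := fun w hw => by
    rw [uIcc_of_le hv.le] at hw
    have := pow_le_pow_left₀ hw.1 hw.2 2
    simp only [comp_primitiveInv_congr hfg hf hpos hg (by linarith : 0 < C - w ^ 2 / 2)]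
  rw [intervalIntegral.integral_congr hint]

lemma IsSolution.congr (hpos : ∀ x, 0 < f x) (hα : 0 < α) (hμ : 0 < μ) (hL : 0 < L) {u : ℝ → ℝ}
    (h : IsSolution f α μ L u) : IsSolution g α μ L u := by
  obtain ⟨p, hp⟩ := isSolution_iff.1 h
  exact isSolution_iff.2 ⟨p, { hp with
    hasDerivAt_snd := fun x hx => by
      have hux := (hp.pos hpos hα hμ hL (Ioo_subset_Icc_self hx)).le
      exact hfg hux ▸ hp.hasDerivAt_snd x hx }⟩

lemma isExtremalParameter_congr (hf : ∀ x, 0 < f x) (hg : ∀ x, 0 < g x) (hα : 0 < α)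
    (hL : 0 < L) {lamStar : ℝ} (h : IsExtremalParameter g α L lamStar) :
    IsExtremalParameter f α L lamStar :=
  ⟨h.1, fun μ hμ hle => (h.2.1 μ hμ hle).imp fun _ hu => hu.congr hfg.symm hg hα hμ hL,
    fun μ hlt ⟨u, hu⟩ => h.2.2 μ hlt ⟨u, hu.congr hfg hf hα (h.1.trans hlt) hL⟩⟩

end Congr

end RobinPhasePlane

open RobinPhasePlane Set Filter Topology in
theorem mainTheorem4_general {f : ℝ → ℝ} (hf : Continuous f) (hpos : ∀ u, 0 < f u)
    (hsuper : Tendsto (fun u => f u / u) atTop atTop) (hconv : StrictConvexOn ℝ (Ici 0) f)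
    {α L₀ : ℝ} (hα : 0 < α) (hL₀ : 0 < L₀) :
    ∃ lam : ℝ → ℝ,
      (∀ C, 0 < C → ∀ μ, (0 < μ ∧ IsLength f α μ C L₀) ↔ μ = lam C) ∧
      Tendsto lam (𝓝[>] 0) (𝓝 0) ∧
      Tendsto lam atTop (𝓝 0) ∧
      ∃ Cstar, 0 < Cstar ∧ StrictMonoOn lam (Ioo 0 Cstar) ∧ StrictAntiOn lam (Ioi Cstar) ∧
        IsExtremalParameter f α L₀ (lam Cstar) := by
  have hfg := eqOn_trunc f
  have hg := admissible_trunc hf (fun u _ => hpos u) (tendsto_atTop_of_tendsto_div hsuper)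
  have hsuper' : Tendsto (fun u => trunc f u / u) atTop atTop := hsuper.congr' (by
    filter_upwards [eventually_ge_atTop 0] with u hu using by rw [hfg hu])
  have hzero := hg.tendsto_robinParameter_zero hα hL₀
  have htop := hg.tendsto_robinParameter_atTop hsuper' hα hL₀
  obtain ⟨Cstar, hCstar, hmono, hanti, himage⟩ := exists_strictMonoOn_strictAntiOn
    (hg.continuousOn_robinParameter hα hL₀) (fun C => hg.robinParameter_pos hα hL₀) hzero htop
    fun A B C hA hAB hBC => hg.not_three_robinParameter (hconv.congr hfg) hα hL₀ hA hAB hBC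
  refine ⟨robinParameter (trunc f) α L₀, fun C hC μ => ?_, hzero, htop, Cstar, hCstar, hmono, hanti,
    isExtremalParameter_congr hfg hpos hg.pos hα hL₀ <| hg.isExtremalParameter_of_image_eq hα hL₀
      (hg.robinParameter_pos hα hL₀ hCstar) himage⟩
  rw [isLength_congr hfg hf hpos hg.toUniformlyPositive]
  exact hg.isLength_iff_eq_robinParameter hα hL₀ hC

theorem mainTheorem4 (f : ℝ → ℝ)
    (hf1 : Differentiable ℝ f) (hf2 : Differentiable ℝ (deriv f))
    (hpos : ∀ u, 0 < f u) (hmono : ∀ u, 0 ≤ deriv f u)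
    (hsuper : Filter.Tendsto (fun u => f u / u) Filter.atTop Filter.atTop)
    (hconv : ∀ u, 0 < deriv (deriv f) u)
    (α : ℝ) (hα : 0 < α) (L₀ : ℝ) (hL₀ : 0 < L₀) :
    ∃ lam : ℝ → ℝ,
      (∀ C : ℝ, 0 < C → ∀ μ : ℝ,
        (0 < μ ∧ RobinPhasePlane.IsLength f α μ C L₀) ↔ μ = lam C) ∧
      Filter.Tendsto lam (nhdsWithin 0 (Set.Ioi 0)) (nhds 0) ∧
      Filter.Tendsto lam Filter.atTop (nhds 0) ∧
      ∃ Cstar : ℝ, 0 < Cstar ∧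
        StrictMonoOn lam (Set.Ioo 0 Cstar) ∧
        StrictAntiOn lam (Set.Ioi Cstar) ∧
        RobinPhasePlane.IsExtremalParameter f α L₀ (lam Cstar) :=
  mainTheorem4_general hf1.continuous hpos hsuper ((strictConvexOn_univ_of_deriv2_pos
    hf1.continuous hconv).subset (Set.subset_univ _) (convex_Ici 0)) hα hL₀
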